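/- **Conventions.** Variables come from an infinite set. An xor-clause in normal form is an equation $x_1\oplus\dots\oplus x_k\equiv p$ with distinct variables $x_1,\dots,x_k$ ($k\ge 0$) and $p\in\{\bot,\top\}$; every sum is brought to this form by cancelling equal variables in pairs. The clause with $k=0$ and $p=\top$ is $\bot$ (false); a literal is an xor-clause with $k\le 1$. A conjunction $\varphi$ is a finite set of xor-clauses and $\mathrm{vars}(\varphi)$ is its set of variables. It is in *3-xor normal form* if each of its clauses has exactly three variables and any two different clauses share at most one variable. **UP.** $\psi\vdash_{\mathrm{up}}D$ means that $D$ is obtained from the clauses in $\psi$ by the rule: from $x\equiv b$ and $C$ derive $C[x/b]$. **EC.** $\psi\vdash_{\mathrm{ec}}D$ means that $D$ is obtained from the clauses in $\psi$ by the following rules (with distinct variables within each clause): - from $x\equiv\top$ and $x\equiv\bot$ derive $\bot$; - from $x\equiv p$ and $x\oplus y\equiv q$ derive $y\equiv p\oplus q$; - from $x\equiv p$ and $x\oplus y\oplus z\equiv q$ derive $y\oplus z\equiv p\oplus q$; - for $n\ge2$, from $x_i\oplus x_{i+1}\equiv p_i$ ($1\le i<n$) and $x_1\oplus x_n\oplus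 y\equiv q$ derive $y\equiv p_1\oplus\dots\oplus p_{n-1}\oplus q$; - for $n\ge2$, from $x_i\oplus x_{i+1}\equiv p_i$ ($1\le i<n$) and $x_n\oplus x_1\equiv q$ with $p_1\oplus\dots\oplus p_{n-1}\oplus q=\top$ derive $\bot$. **EC-simulation formula.** A conjunction $\psi$ is an EC-simulation formula for $\varphi$ if 1. the satisfying truth assignments of $\varphi$ and of $\varphi\wedge\psi$ are the same when projected to $\mathrm{vars}(\varphi)$, and 2. for all literals $\tilde l_1,\dots,\tilde l_m$ and $\hat l$ with $\varphi\wedge\tilde l_1\wedge\dots\wedge\tilde l_m\vdash_{\mathrm{ec}}\hat l$, we have $\varphi\wedge\psi\wedge\tilde l_1\wedge\dots\wedge\tilde l_m\vdash_{\mathrm{up}}\hat l$, unless $\varphi\wedge\psi\wedge\tilde l_1\wedge\dots\wedge\tilde l_m\vdash_{\mathrm{up}}\bot$, that is, unless unit propagation already detects a conflict. **The translation $\mathrm{Eq}^\star(\varphi)$.** Start with $\varphi'=\varphi$ and $V=\mathrm{vars}(\varphi)$. While $V\neq\emptyset$: - Remove from $V$ a variable $v=x_j$ minimizing $|\mathrm{vars}(\{C\in\varphi'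 : v\in\mathrm{vars}(C)\})\cap V|$. - For each pair of clauses $(x_i\oplus x_j\oplus e_{ij}\equiv p_{ij})$, $(x_j\oplus x_k\oplus e_{jk}\equiv p_{jk})$ in $\varphi'$ with $x_i,x_k\in V$ and $x_i,x_j,x_k$ distinct (in any order; pairs that arise only during this loop may be treated or not): - if $\varphi'$ has a ternary clause $(x_i\oplus x_k\oplus y\equiv p')$, put $e_{ik}:=y$ and $p_{ik}:=p'$. If there are several such clauses, any may be taken, but there is only one $e_{ik}$ and $p_{ik}$ for each pair $\{x_i,x_k\}$ throughout the run: a clause of $\varphi$ that contains $x_i$ and $x_k$ has priority, and a choice made once for the pair is kept; - otherwise let $e_{ik}$ be a new variable, put $p_{ik}:=\top$, and add $(x_i\oplus x_k\oplus e_{ik}\equiv p_{ik})$ to $\varphi'$; - in both cases add $(e_{ij}\oplus e_{jk}\oplus e_{ik}\equiv p_{ij}\oplus p_{jk}\oplus p_{ik})$ to $\varphi'$. Finally return $\varphi'\setminus\varphi$. **Theorem.** Let $\varphi$ be a conjunction of xor-clauses in 3-xor normal form. Then the translation has an output on $\varphi$, and every output $\mathrm{Eq}^\star(\varphi)$, whatever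 choices are made in the run, is an EC-simulation formula for $\varphi$. -/

import Mathlib

/-- An xor-clause over the variables `α` in normal form: the equation
`x₁ ⊕ ⋯ ⊕ xₖ ≡ parity`, where `x₁, …, xₖ` are the distinct elements of `vars`
(`1` is true, `0` is false). The constant `⊤` as a summand is absorbed in `parity`. -/
@[ext]
structure XorClause (α : Type*) where
  vars : Finset α
  parity : ZMod 2
deriving DecidableEq

namespace XorClause

variable {α : Type*} [DecidableEq α]

/-- The normal form of `a₁ ⊕ ⋯ ⊕ aₙ ≡ p`: pairs of equal summands cancel. -/
def eqn (l : List α) (p : ZMod 2) : XorClause α :=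
  ⟨l.foldr (fun a s => symmDiff {a} s) ∅, p⟩

/-- The false clause: the empty sum equated with true. -/
def falsum : XorClause α := ⟨∅, 1⟩

/-- The result of replacing the variable `x` by the constant `b`, in normal form. -/
def assign (C : XorClause α) (x : α) (b : ZMod 2) : XorClause α :=
  if x ∈ C.vars then ⟨C.vars.erase x, C.parity - b⟩ else C

/-- Literals seen as xor-clauses: `x`, `¬ x`, `⊤`, `⊥`. -/
def IsLiteral (C : XorClause α) : Prop := C.vars.card ≤ 1

/-- Satisfaction of an xor-clause by a truth assignment. -/
def Sat (τ : α → ZMod 2) (C : XorClause α) : Prop := ∑ x ∈ C.vars, τ x = C.parity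

/-- The variables of a conjunction of xor-clauses. -/
def varsOf (φ : Finset (XorClause α)) : Finset α := φ.biUnion XorClause.vars

/-- 3-xor normal form. -/
def Is3XorNF (φ : Finset (XorClause α)) : Prop :=
  (∀ C ∈ φ, C.vars.card = 3) ∧
    ∀ C ∈ φ, ∀ D ∈ φ, C ≠ D → (C.vars ∩ D.vars).card ≤ 1

/-- Derivability by unit propagation on xor-clauses. -/
inductive UP (Ψ : Finset (XorClause α)) : XorClause α → Prop
  | ax {C : XorClause α} : C ∈ Ψ → UP Ψ C
  | unitPos {x : α} {C : XorClause α} :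
      UP Ψ (eqn [x] 1) → UP Ψ C → UP Ψ (C.assign x 1)
  | unitNeg {x : α} {C : XorClause α} :
      UP Ψ (eqn [x] 0) → UP Ψ C → UP Ψ (C.assign x 0)

/-- Derivability by equivalence-class based parity reasoning. In the last two rules the
variables of the chain are `x 0, …, x (n - 1)`. -/
inductive EC (Ψ : Finset (XorClause α)) : XorClause α → Prop
  | ax {C : XorClause α} : C ∈ Ψ → EC Ψ C
  | conflict {x : α} : EC Ψ (eqn [x] 1) → EC Ψ (eqn [x] 0) → EC Ψ falsum
  | unit2 {x y : α} {p q : ZMod 2} : [x, y].Nodup →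
      EC Ψ (eqn [x] p) → EC Ψ (eqn [x, y] q) → EC Ψ (eqn [y] (p + q))
  | unit3 {x y z : α} {p q : ZMod 2} : [x, y, z].Nodup →
      EC Ψ (eqn [x] p) → EC Ψ (eqn [x, y, z] q) → EC Ψ (eqn [y, z] (p + q))
  | imply {n : ℕ} {x : ℕ → α} {p : ℕ → ZMod 2} {y : α} {q : ZMod 2} : 2 ≤ n →
      (∀ i < n - 1, x i ≠ x (i + 1)) →
      (∀ i < n - 1, EC Ψ (eqn [x i, x (i + 1)] (p i))) →
      [x 0, x (n - 1), y].Nodup →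
      EC Ψ (eqn [x 0, x (n - 1), y] q) →
      EC Ψ (eqn [y] (∑ i ∈ Finset.range (n - 1), p i + q))
  | xorConflict {n : ℕ} {x : ℕ → α} {p : ℕ → ZMod 2} {q : ZMod 2} : 2 ≤ n →
      (∀ i < n - 1, x i ≠ x (i + 1)) →
      (∀ i < n - 1, EC Ψ (eqn [x i, x (i + 1)] (p i))) →
      x (n - 1) ≠ x 0 →
      EC Ψ (eqn [x (n - 1), x 0] q) →
      ∑ i ∈ Finset.range (n - 1), p i + q = 1 →
      EC Ψ falsum

/-- `ψ` is an EC-simulation formula for `φ`: adding `ψ` does not change the satisfying truth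
assignments, projected to the variables of `φ`, and under all assumption literals, unit
propagation on `φ ∧ ψ` derives every literal that is EC-derivable from `φ`, unless it derives
a conflict. -/
def IsECSimulation (φ ψ : Finset (XorClause α)) : Prop :=
  ((fun (τ : α → ZMod 2) (x : varsOf φ) => τ x) '' {τ | ∀ C ∈ φ, Sat τ C} =
    (fun (τ : α → ZMod 2) (x : varsOf φ) => τ x) '' {τ | ∀ C ∈ φ ∪ ψ, Sat τ C}) ∧
  ∀ A : Finset (XorClause α), (∀ C ∈ A, IsLiteral C) →
    ∀ l : XorClause α, IsLiteral l → EC (φ ∪ A) l →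
      UP ((φ ∪ ψ) ∪ A) l ∨ UP ((φ ∪ ψ) ∪ A) falsum

/-! ### The optimized translation -/

/-- The ternary xor-clause `x ⊕ y ⊕ z ≡ p` belongs to `φ`. -/
def HasTernary (φ : Finset (XorClause α)) (x y z : α) (p : ZMod 2) : Prop :=
  [x, y, z].Nodup ∧ eqn [x, y, z] p ∈ φ

/-- A state of the translation: the current conjunction, and the table that records the
bridging variable `e_ik` and the parity `p_ik` of a pair of variables. -/
structure TransState (α : Type*) where
  clauses : Finset (XorClause α)
  bridge : Set (Sym2 α × α × ZMod 2)

/-- At the start a pair that occurs in a clause of `φ` is bridged by this clause; no other pair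
is bridged yet. -/
def initState (φ : Finset (XorClause α)) : TransState α where
  clauses := φ
  bridge := {t | ∃ i k y p, HasTernary φ i k y p ∧ t = (s(i, k), y, p)}

/-- The data of one iteration of the inner loop: the clauses `x_i ⊕ x_j ⊕ e_ij ≡ p_ij` and
`x_j ⊕ x_k ⊕ e_jk ≡ p_jk`, for the variable `x_j` being eliminated. -/
structure Inst (α : Type*) where
  i : α
  eij : α
  pij : ZMod 2
  k : α
  ejk : α
  pjk : ZMod 2

/-- The condition of the inner loop, where `V` holds the variables not yet eliminated. -/
def Inst.Valid (t : Inst α) (φ : Finset (XorClause α)) (V : Finset α) (j : α) : Prop :=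
  [t.i, j, t.k].Nodup ∧ t.i ∈ V ∧ t.k ∈ V ∧
    HasTernary φ t.i j t.eij t.pij ∧ HasTernary φ j t.k t.ejk t.pjk

/-- The body of the inner loop. If some clause contains `x_i` and `x_k`, its third variable is
used as `e_ik`, where a recorded choice for the pair is kept; otherwise `e_ik` is a new
variable. -/
inductive Body (t : Inst α) (S : TransState α) : TransState α → Prop
  | reuse {y : α} {q : ZMod 2} :
      HasTernary S.clauses t.i t.k y q →
      (∀ y' q', (s(t.i, t.k), y', q') ∈ S.bridge → y' = y ∧ q' = q) →
      Body t S
        { clauses := insert (eqn [t.eij, t.ejk, y] (t.pij + t.pjk + q)) S.clauses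
          bridge := insert (s(t.i, t.k), y, q) S.bridge }
  | fresh {y : α} :
      (∀ y' q', ¬ HasTernary S.clauses t.i t.k y' q') →
      y ∉ varsOf S.clauses →
      Body t S
        { clauses := insert (eqn [t.eij, t.ejk, y] (t.pij + t.pjk + 1))
            (insert (eqn [t.i, t.k, y] 1) S.clauses)
          bridge := insert (s(t.i, t.k), y, 1) S.bridge }

/-- Successive iterations of the inner loop. -/
inductive Iterate (V : Finset α) (j : α) :
    List (Inst α) → TransState α → TransState α → Prop
  | nil {S : TransState α} : Iterate V j [] S S
  | cons {t : Inst α} {L : List (Inst α)} {S S' S'' : TransState α} :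
      t.Valid S.clauses V j → Body t S S' → Iterate V j L S' S'' →
      Iterate V j (t :: L) S S''

/-- The whole inner loop, in any order: every pair of clauses that meets the condition when the
loop is entered is treated; pairs that arise during the loop may be treated too. -/
def InnerLoop (V : Finset α) (j : α) (S S' : TransState α) : Prop :=
  ∃ L : List (Inst α), (∀ t : Inst α, t.Valid S.clauses V j → t ∈ L) ∧ Iterate V j L S S'

/-- The quantity minimized in the choice of the next variable. -/
def cost (φ : Finset (XorClause α)) (V : Finset α) (v : α) : ℕ :=
  (varsOf (φ.filter fun C => v ∈ C.vars) ∩ V).card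

/-- The outer loop, from a set `V` of remaining variables and a state to the final
conjunction. -/
inductive Run : Finset α → TransState α → Finset (XorClause α) → Prop
  | done {S : TransState α} : Run ∅ S S.clauses
  | step {V : Finset α} {j : α} {S S' : TransState α} {R : Finset (XorClause α)} :
      j ∈ V → (∀ v ∈ V, cost S.clauses V j ≤ cost S.clauses V v) →
      InnerLoop (V.erase j) j S S' → Run (V.erase j) S' R → Run V S R

/-- `ψ` is an output `Eq*(φ)` of the optimized translation on the input `φ`. -/
def IsEqStar (φ ψ : Finset (XorClause α)) : Prop :=
  ∃ R, Run (varsOf φ) (initState φ) R ∧ ψ = R \ φ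

end XorClause

/-! The argument is vertex elimination. View a recorded entry `(s(i, k), e, p)` of the table as
an edge between `i` and `k`, which is *active* when unit propagation derives `e ≡ b`; it then
says `i ⊕ k ≡ p + b`. A derivation in `EC` only ever uses binary clauses that are active edges of
`φ`, so its two chain rules ask for the parity around a closed walk of active edges, one of which
may still have to be activated.

Suppose that unit propagation on the output, together with the assumptions, finds no conflict.
`TransState.HasPotential` says that the active edges inside the set `V` of remaining variables
are explained by a colouring `c` into classes and a potential `σ`: an active edge joins variables
of the same class and its parity is the difference of the potentials, and conversely every
recorded edge inside a class is active. Without remaining variables this is trivial, and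
`TransState.HasPotential.of_erase` shows that it propagates backwards through the elimination of a
variable `j`: if `j` has an active edge to `i`, then `j` joins the class of `i`, and for any
other edge from `j` to `k` the inner loop has recorded an edge from `i` to `k` and a clause
that lets unit propagation pass between the edges `jk` and `ik` of the triangle. The table
matters because it gives at most one edge for each pair of variables, so that two edges from `j` to
the same `i` cannot disagree. At the start of the run the property settles the chain rules by
telescoping the potential along the chain.

Models extend through the run because each new clause is a consequence of the earlier ones or
defines a new variable. An output exists because the table is functional and backed by clauses
(`TransState.Coherent`), so that the body of the loop never gets stuck. -/

namespace XorClause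

variable {α : Type*} [DecidableEq α]

/-! ### Clauses in normal form -/

theorem eqn_vars_cons (a : α) (l : List α) (p q : ZMod 2) :
    (eqn (a :: l) p).vars = symmDiff {a} (eqn l q).vars := rfl

theorem eqn_vars_of_nodup {l : List α} (hl : l.Nodup) (p : ZMod 2) :
    (eqn l p).vars = l.toFinset := by
  induction l with
  | nil => rfl
  | cons a l ih =>
    obtain ⟨ha, hl⟩ := List.nodup_cons.1 hl
    rw [eqn_vars_cons a l p p, ih hl]
    ext x
    simp only [Finset.mem_symmDiff, Finset.mem_singleton, List.mem_toFinset,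
      List.toFinset_cons, Finset.mem_insert]
    by_cases hx : x = a
    · subst hx; simp [ha]
    · simp [hx]

theorem eqn_of_nodup {l : List α} (hl : l.Nodup) (p : ZMod 2) :
    eqn l p = ⟨l.toFinset, p⟩ :=
  XorClause.ext (eqn_vars_of_nodup hl p) rfl

theorem eqn_swap (a b : α) (l : List α) (p : ZMod 2) :
    eqn (a :: b :: l) p = eqn (b :: a :: l) p :=
  XorClause.ext (symmDiff_left_comm ({a} : Finset α) {b} (eqn l p).vars) rfl

theorem eqn_cancel (a : α) (l : List α) (p : ZMod 2) : eqn (a :: a :: l) p = eqn l p :=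
  XorClause.ext (symmDiff_symmDiff_cancel_left ({a} : Finset α) (eqn l p).vars) rfl

theorem eqn_cons_swap (a b c : α) (p : ZMod 2) : eqn [a, b, c] p = eqn [a, c, b] p := by
  have h := congrArg XorClause.vars (eqn_swap b c [] p)
  exact XorClause.ext (congrArg (symmDiff ({a} : Finset α)) h) rfl

theorem eqn_singleton (x : α) (p : ZMod 2) : eqn [x] p = ⟨{x}, p⟩ :=
  eqn_of_nodup (List.nodup_singleton x) p

theorem sum_symmDiff (τ : α → ZMod 2) (s t : Finset α) :
    ∑ x ∈ symmDiff s t, τ x = ∑ x ∈ s, τ x + ∑ x ∈ t, τ x := by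
  have hs := Finset.sum_sdiff (f := τ) (Finset.inter_subset_left (s₁ := s) (s₂ := t))
  have ht := Finset.sum_sdiff (f := τ) (Finset.inter_subset_right (s₁ := s) (s₂ := t))
  rw [Finset.sdiff_inter_self_left] at hs
  rw [Finset.sdiff_inter_self_right] at ht
  have hd : Disjoint (s \ t) (t \ s) := disjoint_sdiff_sdiff
  rw [symmDiff, Finset.sup_eq_union, Finset.sum_union hd, ← hs, ← ht]
  linear_combination -(CharTwo.add_self_eq_zero (∑ x ∈ s ∩ t, τ x))

theorem sat_eqn {τ : α → ZMod 2} {l : List α} {p : ZMod 2} :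
    Sat τ (eqn l p) ↔ (l.map τ).sum = p := by
  have h : ∑ x ∈ (eqn l p).vars, τ x = (l.map τ).sum := by
    induction l with
    | nil => rfl
    | cons a l ih =>
      rw [eqn_vars_cons a l p p, sum_symmDiff, ih, Finset.sum_singleton, List.map_cons,
        List.sum_cons]
  rw [Sat, h]
  rfl

omit [DecidableEq α] in
theorem Sat.congr {τ τ' : α → ZMod 2} {C : XorClause α} (h : ∀ x ∈ C.vars, τ' x = τ x)
    (hC : Sat τ C) : Sat τ' C :=
  (Finset.sum_congr rfl h).trans hC

/-! ### Ternary clauses -/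

theorem HasTernary.mono {φ ψ : Finset (XorClause α)} (h : φ ⊆ ψ) {x y z : α} {p : ZMod 2}
    (hx : HasTernary φ x y z p) : HasTernary ψ x y z p :=
  ⟨hx.1, h hx.2⟩

theorem HasTernary.swap {φ : Finset (XorClause α)} {x y z : α} {p : ZMod 2}
    (h : HasTernary φ x y z p) : HasTernary φ y x z p :=
  ⟨(List.Perm.swap y x [z]).nodup h.1, eqn_swap x y [z] p ▸ h.2⟩

theorem HasTernary.ne {φ : Finset (XorClause α)} {x y z : α} {p : ZMod 2}
    (h : HasTernary φ x y z p) : x ≠ y := by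
  rintro rfl
  simpa using h.1

theorem HasTernary.mem_varsOf {φ : Finset (XorClause α)} {x y z : α} {p : ZMod 2}
    (h : HasTernary φ x y z p) : x ∈ varsOf φ ∧ y ∈ varsOf φ ∧ z ∈ varsOf φ := by
  have hv : ∀ w ∈ [x, y, z], w ∈ varsOf φ := fun w hw =>
    Finset.mem_biUnion.2 ⟨_, h.2, by rw [eqn_vars_of_nodup h.1]; exact List.mem_toFinset.2 hw⟩
  exact ⟨hv x (by simp), hv y (by simp), hv z (by simp)⟩

theorem HasTernary.sat {φ : Finset (XorClause α)} {x y z : α} {p : ZMod 2}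
    (h : HasTernary φ x y z p) {τ : α → ZMod 2} (hτ : ∀ C ∈ φ, Sat τ C) :
    τ x + τ y + τ z = p := by
  have := sat_eqn.1 (hτ _ h.2)
  simpa [add_assoc] using this

/-- In 3-xor normal form a pair of variables determines the clause that contains it. -/
theorem Is3XorNF.ternary_unique {φ : Finset (XorClause α)} (hφ : Is3XorNF φ)
    {x y z z' : α} {p p' : ZMod 2} (h : HasTernary φ x y z p) (h' : HasTernary φ x y z' p') :
    z = z' ∧ p = p' := by
  have heq : eqn [x, y, z] p = eqn [x, y, z'] p' := by
    by_contra hne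
    have hcard := hφ.2 _ h.2 _ h'.2 hne
    have hsub : ({x, y} : Finset α) ⊆ (eqn [x, y, z] p).vars ∩ (eqn [x, y, z'] p').vars := by
      rw [eqn_vars_of_nodup h.1, eqn_vars_of_nodup h'.1]
      intro w
      simp only [Finset.mem_insert, Finset.mem_singleton, Finset.mem_inter, List.mem_toFinset,
        List.mem_cons]
      tauto
    have := Finset.card_le_card hsub
    rw [Finset.card_pair h.ne] at this
    omega
  refine ⟨?_, congrArg XorClause.parity heq⟩
  have hz : z ∈ (eqn [x, y, z'] p').vars := by
    rw [← heq, eqn_vars_of_nodup h.1]; simp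
  rw [eqn_vars_of_nodup h'.1] at hz
  have h1 := h.1
  simp at hz h1
  tauto

/-! ### Unit propagation -/

theorem UP.assign {Ψ : Finset (XorClause α)} {x : α} {b : ZMod 2} {C : XorClause α}
    (hx : UP Ψ (eqn [x] b)) (hC : UP Ψ C) : UP Ψ (C.assign x b) := by
  obtain rfl | rfl : b = 0 ∨ b = 1 := by clear hx; revert b; decide
  · exact .unitNeg hx hC
  · exact .unitPos hx hC

theorem UP.unit_unique {Ψ : Finset (XorClause α)} (hΨ : ¬ UP Ψ falsum) {x : α} {b b' : ZMod 2}
    (h : UP Ψ (eqn [x] b)) (h' : UP Ψ (eqn [x] b')) : b = b' := by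
  by_contra hne
  have := h.assign h'
  rw [eqn_singleton] at this
  have h1 : b' - b = 1 := by clear this h h'; revert b b'; decide
  simp only [XorClause.assign, Finset.mem_singleton, if_true, h1] at this
  exact hΨ (by simpa [falsum] using this)

theorem UP.cons {Ψ : Finset (XorClause α)} {x : α} {l : List α} {b p : ZMod 2}
    (hl : (x :: l).Nodup) (hx : UP Ψ (eqn [x] b)) (h : UP Ψ (eqn (x :: l) p)) :
    UP Ψ (eqn l (b + p)) := by
  have := hx.assign h
  rw [eqn_of_nodup hl] at this
  simp only [XorClause.assign, List.toFinset_cons, Finset.mem_insert_self, if_true] at this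
  rw [Finset.erase_insert (by simpa using (List.nodup_cons.1 hl).1), CharTwo.sub_eq_add,
    add_comm p b] at this
  rwa [eqn_of_nodup (List.nodup_cons.1 hl).2]

/-- Without a conflict, two known variables of a sum of three give the third, also where the
variables coincide and the normal form of the clause is shorter. -/
theorem UP.third {Ψ : Finset (XorClause α)} (hΨ : ¬ UP Ψ falsum) {x y z : α} {b b' p : ZMod 2}
    (hx : UP Ψ (eqn [x] b)) (hy : UP Ψ (eqn [y] b')) (h : UP Ψ (eqn [x, y, z] p)) :
    UP Ψ (eqn [z] (p + b + b')) := by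
  by_cases hxy : x = y
  · subst hxy
    rw [eqn_cancel] at h
    rw [UP.unit_unique hΨ hy hx, add_assoc, CharTwo.add_self_eq_zero, add_zero]
    exact h
  by_cases hxz : x = z
  · subst hxz
    rw [eqn_cons_swap, eqn_cancel] at h
    rw [UP.unit_unique hΨ hy h, add_right_comm, CharTwo.add_self_eq_zero, zero_add]
    exact hx
  by_cases hyz : y = z
  · subst hyz
    rw [eqn_swap, eqn_cons_swap, eqn_cancel] at h
    rw [UP.unit_unique hΨ h hx, CharTwo.add_self_eq_zero, zero_add]
    exact hy
  have h1 := UP.cons (by simp [hxy, hxz, hyz]) hx h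
  have h2 := UP.cons (by simp [hyz]) hy h1
  rwa [show p + b + b' = b' + (b + p) by ring]

/-! ### The states of the translation -/

/-- The table of bridging variables is backed by clauses and assigns at most one bridge to a
pair of variables. -/
structure TransState.Coherent (S : TransState α) : Prop where
  hasTernary : ∀ {i k y q}, (s(i, k), y, q) ∈ S.bridge → HasTernary S.clauses i k y q
  unique : ∀ {s y q y' q'}, (s, y, q) ∈ S.bridge → (s, y', q') ∈ S.bridge → y' = y ∧ q' = q

theorem coherent_initState {φ : Finset (XorClause α)} (hφ : Is3XorNF φ) :
    (initState φ).Coherent := by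
  have key : ∀ {i k y q}, (s(i, k), y, q) ∈ (initState φ).bridge → HasTernary φ i k y q := by
    rintro i k y q ⟨i', k', y', q', h, he⟩
    simp only [Prod.mk.injEq, Sym2.eq_iff] at he
    obtain ⟨⟨rfl, rfl⟩ | ⟨rfl, rfl⟩, rfl, rfl⟩ := he
    · exact h
    · exact h.swap
  refine ⟨key, ?_⟩
  intro s y q y' q' h h'
  induction s with
  | _ i k => exact hφ.ternary_unique (key h') (key h)

theorem nodup_of_notMem_varsOf {φ : Finset (XorClause α)} {i k y : α} (hik : i ≠ k)
    (hi : i ∈ varsOf φ) (hk : k ∈ varsOf φ) (hy : y ∉ varsOf φ) : [i, k, y].Nodup := by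
  have h1 : i ≠ y := fun h => hy (h ▸ hi)
  have h2 : k ≠ y := fun h => hy (h ▸ hk)
  simp [hik, h1, h2]

theorem Inst.Valid.mono {t : Inst α} {φ ψ : Finset (XorClause α)} (h : φ ⊆ ψ) {V : Finset α}
    {j : α} (ht : t.Valid φ V j) : t.Valid ψ V j :=
  ⟨ht.1, ht.2.1, ht.2.2.1, ht.2.2.2.1.mono h, ht.2.2.2.2.mono h⟩

theorem Inst.Valid.ne {t : Inst α} {φ : Finset (XorClause α)} {V : Finset α} {j : α}
    (ht : t.Valid φ V j) : t.i ≠ t.k := by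
  intro h
  have := ht.1
  simp [h] at this

theorem Body.clauses_subset {t : Inst α} {S S' : TransState α} (h : Body t S S') :
    S.clauses ⊆ S'.clauses := by
  cases h with
  | reuse => exact Finset.subset_insert _ _
  | fresh => exact (Finset.subset_insert _ _).trans (Finset.subset_insert _ _)

theorem Body.bridge_subset {t : Inst α} {S S' : TransState α} (h : Body t S S') :
    S.bridge ⊆ S'.bridge := by
  cases h <;> exact Set.subset_insert _ _

theorem Body.treated {t : Inst α} {S S' : TransState α} (h : Body t S S') :
    ∃ y q, (s(t.i, t.k), y, q) ∈ S'.bridge ∧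
      eqn [t.eij, t.ejk, y] (t.pij + t.pjk + q) ∈ S'.clauses := by
  cases h <;> exact ⟨_, _, Set.mem_insert _ _, Finset.mem_insert_self _ _⟩

theorem Body.coherent {t : Inst α} {S S' : TransState α} {V : Finset α} {j : α}
    (h : Body t S S') (ht : t.Valid S.clauses V j) (hS : S.Coherent) : S'.Coherent := by
  have hsub := h.clauses_subset
  -- Both branches record one bridge, which is backed by a clause and agrees with older entries.
  have key : ∀ {y q}, HasTernary S'.clauses t.i t.k y q →
      (∀ y' q', (s(t.i, t.k), y', q') ∈ S.bridge → y' = y ∧ q' = q) →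
      S'.bridge = insert (s(t.i, t.k), y, q) S.bridge → S'.Coherent := by
    intro y q hy hu hb
    refine ⟨?_, ?_⟩
    · intro i k y' q' hm
      rw [hb, Set.mem_insert_iff] at hm
      obtain hm | hm := hm
      · simp only [Prod.mk.injEq, Sym2.eq_iff] at hm
        obtain ⟨⟨rfl, rfl⟩ | ⟨rfl, rfl⟩, rfl, rfl⟩ := hm
        · exact hy
        · exact hy.swap
      · exact (hS.hasTernary hm).mono hsub
    · intro s y₁ q₁ y₂ q₂ h₁ h₂
      rw [hb, Set.mem_insert_iff] at h₁ h₂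
      simp only [Prod.mk.injEq] at h₁ h₂
      obtain ⟨rfl, rfl, rfl⟩ | h₁ := h₁ <;> obtain ⟨h₂', rfl, rfl⟩ | h₂ := h₂
      · exact ⟨rfl, rfl⟩
      · exact hu _ _ h₂
      · subst h₂'
        obtain ⟨rfl, rfl⟩ := hu _ _ h₁
        exact ⟨rfl, rfl⟩
      · exact hS.unique h₁ h₂
  cases h with
  | reuse hy hu => exact key (hy.mono hsub) hu rfl
  | fresh hn hy =>
    refine key ⟨nodup_of_notMem_varsOf ht.ne ht.2.2.2.1.mem_varsOf.1
      ht.2.2.2.2.mem_varsOf.2.1 hy, ?_⟩ (fun y' q' hm => absurd (hS.hasTernary hm) (hn y' q')) rfl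
    exact Finset.mem_insert_of_mem (Finset.mem_insert_self _ _)

theorem Iterate.clauses_subset {V : Finset α} {j : α} {L : List (Inst α)} {S S' : TransState α}
    (h : Iterate V j L S S') : S.clauses ⊆ S'.clauses := by
  induction h with
  | nil => exact subset_rfl
  | cons _ hb _ ih => exact hb.clauses_subset.trans ih

theorem Iterate.bridge_subset {V : Finset α} {j : α} {L : List (Inst α)} {S S' : TransState α}
    (h : Iterate V j L S S') : S.bridge ⊆ S'.bridge := by
  induction h with
  | nil => exact subset_rfl
  | cons _ hb _ ih => exact hb.bridge_subset.trans ih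

theorem Iterate.treated {V : Finset α} {j : α} {L : List (Inst α)} {S S' : TransState α}
    (h : Iterate V j L S S') {t : Inst α} (ht : t ∈ L) :
    ∃ y q, (s(t.i, t.k), y, q) ∈ S'.bridge ∧
      eqn [t.eij, t.ejk, y] (t.pij + t.pjk + q) ∈ S'.clauses := by
  induction h with
  | nil => simp at ht
  | cons _ hb hi ih =>
    obtain rfl | ht := List.mem_cons.1 ht
    · obtain ⟨y, q, h₁, h₂⟩ := hb.treated
      exact ⟨y, q, hi.bridge_subset h₁, hi.clauses_subset h₂⟩
    · exact ih ht

theorem Iterate.coherent {V : Finset α} {j : α} {L : List (Inst α)} {S S' : TransState α}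
    (h : Iterate V j L S S') (hS : S.Coherent) : S'.Coherent := by
  induction h with
  | nil => exact hS
  | cons ht hb _ ih => exact ih (hb.coherent ht hS)

theorem Run.clauses_subset {V : Finset α} {S : TransState α} {R : Finset (XorClause α)}
    (h : Run V S R) : S.clauses ⊆ R := by
  induction h with
  | done => exact subset_rfl
  | step _ _ hL _ ih =>
    obtain ⟨L, -, hL⟩ := hL
    exact hL.clauses_subset.trans ih

/-! ### Existence of an output -/

theorem Body.exists [Infinite α] {t : Inst α} {S : TransState α} (hS : S.Coherent) :
    ∃ S', Body t S S' := by
  by_cases h : ∃ y q, HasTernary S.clauses t.i t.k y q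
  · obtain ⟨y, q, h⟩ := h
    by_cases hb : ∃ y' q', (s(t.i, t.k), y', q') ∈ S.bridge
    · obtain ⟨y', q', hb⟩ := hb
      exact ⟨_, .reuse (hS.hasTernary hb) fun _ _ h' => hS.unique hb h'⟩
    · exact ⟨_, .reuse h fun y' q' h' => absurd ⟨y', q', h'⟩ hb⟩
  · obtain ⟨y, hy⟩ := Infinite.exists_notMem_finset (varsOf S.clauses)
    exact ⟨_, .fresh (fun y' q' h' => h ⟨y', q', h'⟩) hy⟩

theorem Iterate.exists [Infinite α] {V : Finset α} {j : α} (L : List (Inst α)) {S : TransState α}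
    (hS : S.Coherent) (hL : ∀ t ∈ L, t.Valid S.clauses V j) : ∃ S', Iterate V j L S S' := by
  induction L generalizing S with
  | nil => exact ⟨S, .nil⟩
  | cons t L ih =>
    obtain ⟨S₁, h₁⟩ := Body.exists (t := t) hS
    have ht := hL t List.mem_cons_self
    obtain ⟨S', h'⟩ := ih (h₁.coherent ht hS)
      fun u hu => (hL u (List.mem_cons_of_mem t hu)).mono h₁.clauses_subset
    exact ⟨S', .cons ht h₁ h'⟩

theorem finite_valid (φ : Finset (XorClause α)) (V : Finset α) (j : α) :
    {t : Inst α | t.Valid φ V j}.Finite := by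
  let f : Inst α → (α × α × ZMod 2) × (α × α × ZMod 2) :=
    fun t => ((t.i, t.eij, t.pij), (t.k, t.ejk, t.pjk))
  let F : Finset (α × α × ZMod 2) := varsOf φ ×ˢ varsOf φ ×ˢ Finset.univ
  refine Set.Finite.of_finite_image (f := f) ((F ×ˢ F).finite_toSet.subset ?_) ?_
  · rintro _ ⟨t, ht, rfl⟩
    have h₁ := ht.2.2.2.1.mem_varsOf
    have h₂ := ht.2.2.2.2.mem_varsOf
    simp [f, F, h₁, h₂]
  · rintro ⟨⟩ - ⟨⟩ - h
    simp only [f, Prod.mk.injEq] at h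
    obtain ⟨⟨rfl, rfl, rfl⟩, rfl, rfl, rfl⟩ := h
    rfl

theorem InnerLoop.exists [Infinite α] (V : Finset α) (j : α) {S : TransState α}
    (hS : S.Coherent) : ∃ S', InnerLoop V j S S' := by
  have hf := finite_valid S.clauses V j
  obtain ⟨S', h⟩ := Iterate.exists hf.toFinset.toList hS
    (fun t ht => by simpa using ht)
  exact ⟨S', _, fun t ht => by simpa using ht, h⟩

theorem Run.exists [Infinite α] (V : Finset α) {S : TransState α} (hS : S.Coherent) :
    ∃ R, Run V S R := by
  induction hn : V.card generalizing V S with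
  | zero =>
    obtain rfl := Finset.card_eq_zero.1 hn
    exact ⟨_, .done⟩
  | succ n ih =>
    have hne : V.Nonempty := Finset.card_pos.1 (by omega)
    obtain ⟨j, hj, hmin⟩ := Finset.exists_min_image V (cost S.clauses V) hne
    obtain ⟨S', h⟩ := InnerLoop.exists (V.erase j) j hS
    obtain ⟨L, -, hL⟩ := id h
    obtain ⟨R, hR⟩ := ih (V.erase j) (hL.coherent hS)
      (by rw [Finset.card_erase_of_mem hj, hn]; rfl)
    exact ⟨R, .step hj hmin h hR⟩

/-! ### Extension of models -/

theorem varsOf_mono {φ ψ : Finset (XorClause α)} (h : φ ⊆ ψ) : varsOf φ ⊆ varsOf ψ :=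
  Finset.biUnion_subset_biUnion_of_subset_left _ h

theorem Body.exists_model {t : Inst α} {S S' : TransState α} {V : Finset α} {j : α}
    (h : Body t S S') (ht : t.Valid S.clauses V j) {τ : α → ZMod 2}
    (hτ : ∀ C ∈ S.clauses, Sat τ C) :
    ∃ τ' : α → ZMod 2, (∀ x ∈ varsOf S.clauses, τ' x = τ x) ∧ ∀ C ∈ S'.clauses, Sat τ' C := by
  obtain ⟨-, -, -, h₁, h₂⟩ := ht
  -- The clause on the three bridges is the sum of the three clauses of the triangle.
  have triangle : ∀ {τ' : α → ZMod 2} {y : α} {q : ZMod 2}, (∀ C ∈ S.clauses, Sat τ' C) →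
      τ' t.i + τ' t.k + τ' y = q →
      Sat τ' (eqn [t.eij, t.ejk, y] (t.pij + t.pjk + q)) := by
    intro τ' y q hτ' hy
    have e₁ := h₁.sat hτ'
    have e₂ := h₂.sat hτ'
    rw [sat_eqn]
    simp only [List.map_cons, List.map_nil, List.sum_cons, List.sum_nil]
    linear_combination e₁ + e₂ + hy - CharTwo.add_self_eq_zero (τ' t.i) -
      CharTwo.add_self_eq_zero (τ' j) - CharTwo.add_self_eq_zero (τ' t.k)
  cases h with
  | reuse hy _ =>
    refine ⟨τ, fun _ _ => rfl, fun C hC => ?_⟩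
    obtain rfl | hC := Finset.mem_insert.1 hC
    · exact triangle hτ (hy.sat hτ)
    · exact hτ C hC
  | @fresh y _ hy =>
    let τ' := Function.update τ y (1 + τ t.i + τ t.k)
    have hold : ∀ x ∈ varsOf S.clauses, τ' x = τ x := fun x hx =>
      Function.update_of_ne (fun h : x = y => hy (h ▸ hx)) _ _
    have hτ' : ∀ C ∈ S.clauses, Sat τ' C := fun C hC =>
      (hτ C hC).congr fun x hx => hold x (Finset.mem_biUnion.2 ⟨C, hC, hx⟩)
    have hdef : τ' t.i + τ' t.k + τ' y = 1 := by
      rw [hold _ h₁.mem_varsOf.1, hold _ h₂.mem_varsOf.2.1,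
        show τ' y = 1 + τ t.i + τ t.k from Function.update_self _ _ _]
      linear_combination CharTwo.add_self_eq_zero (τ t.i) + CharTwo.add_self_eq_zero (τ t.k)
    refine ⟨τ', hold, fun C hC => ?_⟩
    obtain rfl | hC := Finset.mem_insert.1 hC
    · exact triangle hτ' hdef
    obtain rfl | hC := Finset.mem_insert.1 hC
    · rw [sat_eqn]
      simpa [add_assoc] using hdef
    · exact hτ' C hC

theorem Iterate.exists_model {V : Finset α} {j : α} {L : List (Inst α)} {S S' : TransState α}
    (h : Iterate V j L S S') {τ : α → ZMod 2} (hτ : ∀ C ∈ S.clauses, Sat τ C) :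
    ∃ τ' : α → ZMod 2, (∀ x ∈ varsOf S.clauses, τ' x = τ x) ∧ ∀ C ∈ S'.clauses, Sat τ' C := by
  induction h generalizing τ with
  | nil => exact ⟨τ, fun _ _ => rfl, hτ⟩
  | cons ht hb _ ih =>
    obtain ⟨τ₁, h₁, hτ₁⟩ := hb.exists_model ht hτ
    obtain ⟨τ₂, h₂, hτ₂⟩ := ih hτ₁
    exact ⟨τ₂, fun x hx => (h₂ x (varsOf_mono hb.clauses_subset hx)).trans (h₁ x hx), hτ₂⟩

theorem Run.exists_model {V : Finset α} {S : TransState α} {R : Finset (XorClause α)}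
    (h : Run V S R) {τ : α → ZMod 2} (hτ : ∀ C ∈ S.clauses, Sat τ C) :
    ∃ τ' : α → ZMod 2, (∀ x ∈ varsOf S.clauses, τ' x = τ x) ∧ ∀ C ∈ R, Sat τ' C := by
  induction h generalizing τ with
  | done => exact ⟨τ, fun _ _ => rfl, hτ⟩
  | step _ _ hL _ ih =>
    obtain ⟨L, -, hL⟩ := hL
    obtain ⟨τ₁, h₁, hτ₁⟩ := hL.exists_model hτ
    obtain ⟨τ₂, h₂, hτ₂⟩ := ih hτ₁
    exact ⟨τ₂, fun x hx => (h₂ x (varsOf_mono hL.clauses_subset hx)).trans (h₁ x hx), hτ₂⟩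

/-! ### Classes and potentials of the active edges -/

/-- The bridge `(s(i, k), e, p)` agrees with the classes `c` and the potential `σ`: if unit
propagation on `Ψ` derives `e ≡ b`, so that `i ⊕ k ≡ p + b`, then `i` and `k` lie in one
class and `σ` explains the parity; and if they lie in one class, then some `e ≡ b` is derived. -/
def BridgeFits (Ψ : Finset (XorClause α)) (c : α → α) (σ : α → ZMod 2) (i k e : α)
    (p : ZMod 2) : Prop :=
  (∀ b, UP Ψ (eqn [e] b) → c i = c k ∧ σ i + σ k = p + b) ∧
    (c i = c k → ∃ b, UP Ψ (eqn [e] b))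

theorem BridgeFits.symm {Ψ : Finset (XorClause α)} {c : α → α} {σ : α → ZMod 2} {i k e : α}
    {p : ZMod 2} (h : BridgeFits Ψ c σ i k e p) : BridgeFits Ψ c σ k i e p :=
  ⟨fun b hb => ⟨(h.1 b hb).1.symm, by rw [add_comm]; exact (h.1 b hb).2⟩,
    fun hc => h.2 hc.symm⟩

theorem BridgeFits.congr {Ψ : Finset (XorClause α)} {c c' : α → α} {σ σ' : α → ZMod 2}
    {i k e : α} {p : ZMod 2} (h : BridgeFits Ψ c σ i k e p) (hi : c' i = c i) (hk : c' k = c k)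
    (hi' : σ' i = σ i) (hk' : σ' k = σ k) : BridgeFits Ψ c' σ' i k e p := by
  unfold BridgeFits
  rw [hi, hk, hi', hk']
  exact h

/-- All bridges between variables of `V` agree with common classes and potentials. Classes of
variables in `V` are named by elements of `V`, so that a variable outside `V` can name a new
class. -/
def TransState.HasPotential (S : TransState α) (Ψ : Finset (XorClause α)) (V : Finset α) : Prop :=
  ∃ (c : α → α) (σ : α → ZMod 2), (∀ v ∈ V, c v ∈ V) ∧
    ∀ i ∈ V, ∀ k ∈ V, ∀ e p, (s(i, k), e, p) ∈ S.bridge → BridgeFits Ψ c σ i k e p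

/-- It suffices to extend classes and potentials from `V.erase j` to `j`. -/
theorem TransState.HasPotential.extend {S S' : TransState α} {Ψ : Finset (XorClause α)}
    {V : Finset α} {j : α} (hj : j ∈ V) (hS : S.Coherent) (hb : S.bridge ⊆ S'.bridge)
    {c : α → α} {σ : α → ZMod 2} (hc : ∀ v ∈ V.erase j, c v ∈ V.erase j)
    (h : ∀ i ∈ V.erase j, ∀ k ∈ V.erase j, ∀ e p,
      (s(i, k), e, p) ∈ S'.bridge → BridgeFits Ψ c σ i k e p)
    {a : α} (ha : a ∈ V) {u : ZMod 2}
    (hnew : ∀ k ∈ V.erase j, ∀ e p, (s(j, k), e, p) ∈ S.bridge →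
      (∀ b, UP Ψ (eqn [e] b) → a = c k ∧ u + σ k = p + b) ∧
        (a = c k → ∃ b, UP Ψ (eqn [e] b))) :
    S.HasPotential Ψ V := by
  have hnew' : ∀ k ∈ V.erase j, ∀ e p, (s(j, k), e, p) ∈ S.bridge →
      BridgeFits Ψ (Function.update c j a) (Function.update σ j u) j k e p := by
    intro k hk e p hm
    have hkj := Finset.ne_of_mem_erase hk
    have := hnew k hk e p hm
    unfold BridgeFits
    rwa [Function.update_self, Function.update_self, Function.update_of_ne hkj,
      Function.update_of_ne hkj]
  refine ⟨Function.update c j a, Function.update σ j u, ?_, ?_⟩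
  · intro v hv
    by_cases hvj : v = j
    · subst hvj; rwa [Function.update_self]
    · rw [Function.update_of_ne hvj]
      exact Finset.mem_of_mem_erase (hc v (Finset.mem_erase.2 ⟨hvj, hv⟩))
  · intro i hi k hk e p hm
    have hik := (hS.hasTernary hm).ne
    by_cases hij : i = j
    · subst hij
      exact hnew' k (Finset.mem_erase.2 ⟨hik.symm, hk⟩) e p hm
    by_cases hkj : k = j
    · subst hkj
      exact (hnew' i (Finset.mem_erase.2 ⟨hij, hi⟩) e p (Sym2.eq_swap ▸ hm)).symm
    · exact (h i (Finset.mem_erase.2 ⟨hij, hi⟩) k (Finset.mem_erase.2 ⟨hkj, hk⟩) e p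
        (hb hm)).congr (Function.update_of_ne hij _ _) (Function.update_of_ne hkj _ _)
        (Function.update_of_ne hij _ _) (Function.update_of_ne hkj _ _)

/-- Classes and potentials pass backwards through the elimination of `j`. -/
theorem TransState.HasPotential.of_erase {S S' : TransState α} {Ψ : Finset (XorClause α)}
    (hΨ : ¬ UP Ψ falsum) {V : Finset α} {j : α} (hj : j ∈ V) (hS : S.Coherent)
    (hL : InnerLoop (V.erase j) j S S') (hsub : S'.clauses ⊆ Ψ)
    (h : S'.HasPotential Ψ (V.erase j)) : S.HasPotential Ψ V := by
  obtain ⟨L, hall, hL⟩ := hL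
  obtain ⟨c, σ, hc, hfit⟩ := h
  by_cases hact : ∃ i ∈ V.erase j, ∃ e p b, (s(i, j), e, p) ∈ S.bridge ∧ UP Ψ (eqn [e] b)
  · obtain ⟨i, hi, e₀, p₀, b₀, hm₀, hb₀⟩ := hact
    refine HasPotential.extend hj hS hL.bridge_subset hc hfit (a := c i) (u := σ i + p₀ + b₀)
      (Finset.mem_of_mem_erase (hc i hi)) ?_
    intro k hk e p hm
    by_cases hki : k = i
    · subst hki
      -- Both edges join `j` to the same variable, so they are the same entry of the table.
      obtain ⟨rfl, rfl⟩ := hS.unique hm₀ (Sym2.eq_swap ▸ hm)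
      refine ⟨fun b hb => ⟨rfl, ?_⟩, fun _ => ⟨b₀, hb₀⟩⟩
      rw [UP.unit_unique hΨ hb hb₀]
      linear_combination CharTwo.add_self_eq_zero (σ k)
    · have h₀ := hS.hasTernary hm₀
      have h₁ := hS.hasTernary hm
      have hval : Inst.Valid ⟨i, e₀, p₀, k, e, p⟩ S.clauses (V.erase j) j :=
        ⟨by simp [h₀.ne, h₁.ne, Ne.symm hki], hi, hk, h₀, h₁⟩
      obtain ⟨y, q, hy, hcl⟩ := hL.treated (hall _ hval)
      have hfy := hfit i hi k hk y q hy
      have hcl' : UP Ψ (eqn [e₀, e, y] (p₀ + p + q)) := .ax (hsub hcl)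
      refine ⟨fun b hb => ?_, fun hik => ?_⟩
      · obtain ⟨h₂, h₃⟩ := hfy.1 _ (UP.third hΨ hb₀ hb hcl')
        refine ⟨h₂, ?_⟩
        linear_combination h₃ + CharTwo.add_self_eq_zero q + CharTwo.add_self_eq_zero p₀ +
          CharTwo.add_self_eq_zero b₀
      · obtain ⟨b, hb⟩ := hfy.2 hik
        exact ⟨_, UP.third hΨ hb₀ hb (eqn_cons_swap e₀ e y _ ▸ hcl')⟩
  · -- No edge at `j` is active: `j` becomes a class of its own.
    refine HasPotential.extend hj hS hL.bridge_subset hc hfit (a := j) (u := 0) hj ?_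
    intro k hk e p hm
    refine ⟨fun b hb => absurd ⟨k, hk, e, p, b, Sym2.eq_swap ▸ hm, hb⟩ hact, fun hjk => ?_⟩
    exact absurd hjk.symm (Finset.ne_of_mem_erase (hc k hk))

theorem Run.hasPotential {V : Finset α} {S : TransState α} {R : Finset (XorClause α)}
    (h : Run V S R) (hS : S.Coherent) {Ψ : Finset (XorClause α)} (hR : R ⊆ Ψ)
    (hΨ : ¬ UP Ψ falsum) : S.HasPotential Ψ V := by
  induction h with
  | done => exact ⟨id, 0, by simp, by simp⟩
  | step hj _ hL hrun ih =>
    obtain ⟨L, -, hi⟩ := id hL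
    exact .of_erase hΨ hj hS hL (hrun.clauses_subset.trans hR) (ih (hi.coherent hS) hR)

/-! ### Simulation of the equivalence reasoning -/

theorem card_eqn_vars {l : List α} (hl : l.Nodup) (p : ZMod 2) :
    (eqn l p).vars.card = l.length := by
  rw [eqn_vars_of_nodup hl, List.toFinset_card_of_nodup hl]

/-- What a clause derived in `EC` from `φ` and literals looks like to unit propagation. In
particular ternary clauses come from `φ`, and binary clauses from a ternary clause of `φ` whose
third variable is known. -/
structure Simulated (φ Ψ : Finset (XorClause α)) (C : XorClause α) : Prop where
  up : UP Ψ C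
  ternary : C.vars.card = 3 → C ∈ φ
  binary : ∀ {x y q}, x ≠ y → C = eqn [x, y] q →
    ∃ z p b, HasTernary φ x y z p ∧ UP Ψ (eqn [z] b) ∧ q = p + b

theorem Simulated.of_literal {φ Ψ : Finset (XorClause α)} {C : XorClause α} (hC : IsLiteral C)
    (h : UP Ψ C) : Simulated φ Ψ C where
  up := h
  ternary h3 := by unfold IsLiteral at hC; omega
  binary hxy he := by
    subst he
    rw [IsLiteral, card_eqn_vars (by simpa using hxy)] at hC
    simp at hC

theorem isLiteral_eqn_singleton (x : α) (p : ZMod 2) : IsLiteral (eqn [x] p) := by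
  simp [IsLiteral, eqn_singleton]

/-- A chain of binary clauses stays in one class, and its parity is the difference of the
potentials at its ends. -/
theorem chain_potential {φ Ψ : Finset (XorClause α)} {c : α → α} {σ : α → ZMod 2}
    (hfit : ∀ {i k e p}, HasTernary φ i k e p → BridgeFits Ψ c σ i k e p)
    {x : ℕ → α} {p : ℕ → ZMod 2} {m : ℕ} (hne : ∀ i < m, x i ≠ x (i + 1))
    (h : ∀ i < m, Simulated φ Ψ (eqn [x i, x (i + 1)] (p i))) :
    c (x 0) = c (x m) ∧ σ (x 0) + σ (x m) = ∑ i ∈ Finset.range m, p i := by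
  induction m with
  | zero => simpa using CharTwo.add_self_eq_zero (σ (x 0))
  | succ m ih =>
    obtain ⟨h₁, h₂⟩ := ih (fun i hi => hne i (by omega)) (fun i hi => h i (by omega))
    obtain ⟨z, r, b, ht, hz, hp⟩ := (h m (by omega)).binary (hne m (by omega)) rfl
    obtain ⟨h₃, h₄⟩ := (hfit ht).1 b hz
    refine ⟨h₁.trans h₃, ?_⟩
    rw [Finset.sum_range_succ, hp, ← h₄, ← h₂]
    linear_combination -CharTwo.add_self_eq_zero (σ (x m))

theorem EC.simulated {φ A Ψ : Finset (XorClause α)} (hφ : Is3XorNF φ)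
    (hA : ∀ C ∈ A, IsLiteral C) (hsub : φ ∪ A ⊆ Ψ) (hΨ : ¬ UP Ψ falsum)
    (hpot : (initState φ).HasPotential Ψ (varsOf φ)) {C : XorClause α} (h : EC (φ ∪ A) C) :
    Simulated φ Ψ C := by
  obtain ⟨c, σ, -, hfit⟩ := hpot
  have hfit' : ∀ {i k e p}, HasTernary φ i k e p → BridgeFits Ψ c σ i k e p := fun ht =>
    hfit _ ht.mem_varsOf.1 _ ht.mem_varsOf.2.1 _ _ ⟨_, _, _, _, ht, rfl⟩
  induction h with
  | @ax C hC =>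
    have hup : UP Ψ C := .ax (hsub hC)
    obtain hC | hC := Finset.mem_union.1 hC
    · refine ⟨hup, fun _ => hC, fun {x y q} hxy he => ?_⟩
      subst he
      have h3 := hφ.1 _ hC
      rw [card_eqn_vars (by simpa using hxy)] at h3
      simp at h3
    · exact .of_literal (hA C hC) hup
  | conflict _ _ ih₁ ih₀ => exact absurd (UP.unit_unique hΨ ih₁.up ih₀.up) (by decide)
  | unit2 hn _ _ ih₁ ih₂ =>
    exact .of_literal (isLiteral_eqn_singleton _ _) (UP.cons hn ih₁.up ih₂.up)
  | @unit3 x y z p q hn _ _ ih₁ ih₂ =>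
    have hyz := (List.nodup_cons.1 hn).2
    refine ⟨UP.cons hn ih₁.up ih₂.up, fun h3 => ?_, fun {x' y' q'} hxy he => ?_⟩
    · rw [card_eqn_vars hyz] at h3
      simp at h3
    · have ht : HasTernary φ y z x q := by
        refine ⟨(List.perm_append_comm (l₁ := [x]) (l₂ := [y, z])).nodup hn, ?_⟩
        rw [eqn_cons_swap, eqn_swap]
        exact ih₂.ternary (card_eqn_vars hn q)
      have hq : q' = q + p := by
        rw [add_comm]; exact (congrArg XorClause.parity he).symm
      have hv := congrArg XorClause.vars he
      rw [eqn_vars_of_nodup hyz, eqn_vars_of_nodup (by simpa using hxy)] at hv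
      have hv' : s(y, z) = s(x', y') := by
        ext w
        simpa using Finset.ext_iff.1 hv w
      obtain ⟨rfl, rfl⟩ | ⟨rfl, rfl⟩ := Sym2.eq_iff.1 hv'
      · exact ⟨x, q, p, ht, ih₁.up, hq⟩
      · exact ⟨x, q, p, ht.swap, ih₁.up, hq⟩
  | imply _ hne _ hn _ ih₁ ih₂ =>
    obtain ⟨h₁, h₂⟩ := chain_potential hfit' hne ih₁
    have hy := hfit' ⟨hn, ih₂.ternary (card_eqn_vars hn _)⟩
    obtain ⟨b, hb⟩ := hy.2 h₁
    refine .of_literal (isLiteral_eqn_singleton _ _) ?_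
    rw [← h₂, (hy.1 b hb).2, add_right_comm, CharTwo.add_self_eq_zero, zero_add]
    exact hb
  | xorConflict _ hne _ hn _ hsum ih₁ ih₂ =>
    obtain ⟨h₁, h₂⟩ := chain_potential hfit' hne ih₁
    obtain ⟨z, r, b, ht, hz, hq⟩ := ih₂.binary hn rfl
    have h₃ := ((hfit' ht).1 b hz).2
    rw [hq, ← h₂, ← h₃, add_comm (σ _), CharTwo.add_self_eq_zero] at hsum
    exact absurd hsum (by decide)

theorem IsEqStar.isECSimulation {φ ψ : Finset (XorClause α)} (hφ : Is3XorNF φ)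
    (h : IsEqStar φ ψ) : IsECSimulation φ ψ := by
  obtain ⟨R, hR, rfl⟩ := h
  have hsub : φ ⊆ R := hR.clauses_subset
  rw [IsECSimulation, Finset.union_sdiff_of_subset hsub]
  refine ⟨subset_antisymm ?_ ?_, fun A hA l _ hl => ?_⟩
  · rintro _ ⟨τ, hτ, rfl⟩
    obtain ⟨τ', hold, hτ'⟩ := hR.exists_model hτ
    exact ⟨τ', hτ', funext fun x => hold x x.2⟩
  · exact Set.image_mono fun τ hτ C hC => hτ C (hsub hC)
  · by_cases hΨ : UP (R ∪ A) falsum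
    · exact .inr hΨ
    · exact .inl (EC.simulated hφ hA (Finset.union_subset_union_left hsub) hΨ
        (hR.hasPotential (coherent_initState hφ) Finset.subset_union_left hΨ) hl).up

end XorClause

theorem theorem5 {α : Type*} [DecidableEq α] [Infinite α]
    (φ : Finset (XorClause α)) (hφ : XorClause.Is3XorNF φ) :
    (∃ ψ : Finset (XorClause α), XorClause.IsEqStar φ ψ) ∧
      ∀ ψ : Finset (XorClause α), XorClause.IsEqStar φ ψ → XorClause.IsECSimulation φ ψ := by
  refine ⟨?_, fun ψ hψ => hψ.isECSimulation hφ⟩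
  obtain ⟨R, hR⟩ := XorClause.Run.exists (XorClause.varsOf φ) (XorClause.coherent_initState hφ)
  exact ⟨_, R, hR, rfl⟩
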